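/- For a nonzero polynomial $P\in\mathbb C[x,y]$ let $$ m(P)=\frac1{(2\pi i)^2}\iint_{|x|=|y|=1}\log|P(x,y)|\,\frac{dx}{x}\,\frac{dy}{y} =\frac1{(2\pi)^2}\int_0^{2\pi}\!\!\int_0^{2\pi}\log\bigl|P(e^{is},e^{it})\bigr|\,ds\,dt $$ denote its (logarithmic) Mahler measure. For $k\in\mathbb R$ put $$ P_k(x,y)=(x+1)y^2+(x^2+kx+1)y+(x^2+x), $$ $$ Q_k(X,Y)=Y^2+(X^4+kX^3+2kX^2+kX+1)Y+X^4 . $$ Then for every real $k$ the integrals defining $m(Q_k)$ and $m(P_{2-k})$ converge absolutely, and $$ m(Q_k)=\begin{cases}2\,m(P_{2-k}) & \text{for } 0\le k\le 4,\\ m(P_{2-k}) & \text{for } k\le -1.\end{cases} $$ -/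

import Mathlib

open MvPolynomial in
/-- Boyd's family `P_k(x, y) = (x + 1) y² + (x² + k x + 1) y + (x² + x)`,
with `x = X 0` and `y = X 1`. -/
noncomputable def boydP (k : ℂ) : MvPolynomial (Fin 2) ℂ :=
  (X 0 + 1) * X 1 ^ 2 + (X 0 ^ 2 + C k * X 0 + 1) * X 1 + (X 0 ^ 2 + X 0)

open MvPolynomial in
/-- Bosman's family `Q_k(X, Y) = Y² + (X⁴ + k X³ + 2 k X² + k X + 1) Y + X⁴`,
with `X = X 0` and `Y = X 1`. -/
noncomputable def bosmanQ (k : ℂ) : MvPolynomial (Fin 2) ℂ :=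
  X 1 ^ 2
    + (X 0 ^ 4 + C k * X 0 ^ 3 + C (2 * k) * X 0 ^ 2 + C k * X 0 + 1) * X 1
    + X 0 ^ 4

/-- `log |P|` on the torus `|x| = |y| = 1`, in the coordinates `x = exp(i s)`, `y = exp(i t)`,
`θ = (s, t)`. -/
noncomputable def logNormOnTorus (P : MvPolynomial (Fin 2) ℂ) (θ : ℝ × ℝ) : ℝ :=
  Real.log ‖MvPolynomial.eval
    ![Complex.exp (θ.1 * Complex.I), Complex.exp (θ.2 * Complex.I)] P‖

/-- One period `[0, 2π] × [0, 2π]` of the torus coordinates. -/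
def torusPeriod : Set (ℝ × ℝ) :=
  Set.Icc 0 (2 * Real.pi) ×ˢ Set.Icc 0 (2 * Real.pi)

/-- The integral defining the Mahler measure of `P` converges absolutely. -/
def MahlerIntegrable (P : MvPolynomial (Fin 2) ℂ) : Prop :=
  MeasureTheory.IntegrableOn (logNormOnTorus P) torusPeriod MeasureTheory.volume

/-- The logarithmic Mahler measure
`m(P) = (2πi)⁻² ∬_{|x|=|y|=1} log |P(x, y)| dx/x dy/y`;
under `x = exp(i s)`, `y = exp(i t)` the form `(2πi)⁻² dx/x dy/y` becomes `(2π)⁻² ds dt`. -/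
noncomputable def logMahler (P : MvPolynomial (Fin 2) ℂ) : ℝ :=
  ((2 * Real.pi) ^ 2)⁻¹ * ∫ θ in torusPeriod, logNormOnTorus P θ

/-!
Fix `x` on the unit circle. Jensen's formula in `y` turns `m(Q_k)` and `m(P_{2-k})` into averages
over the circle of `arcosh⁺ (α + β k)`, where `arcosh⁺` vanishes on `[-1, 1]`; for `P` this is up to
`log |x + 1|`, which has mean zero. In both cases `|α| ≤ 1`, so both measures vanish at `k = 0`, and
`log (2 β)` has mean zero, so both are `log |k| + o(1)` as `k → -∞`. It remains to compare their
derivatives in `k`, and both are given by the integral of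
`dp / √((p ^ 2 - 4 (1 + k)) (4 - (p - k) ^ 2))`. For `P` the substitution is `p = k - 2 cos s`
with `x = exp (i s)`. For `Q` it is `p = w + (1 + k) / w` with `w = k - 1 + 2 cos θ` and
`x = exp (i θ)`; the integral is then over the negative half-line in `w` if `k < -1`, where `p` is
injective, and over the positive one if `0 < k < 4`, where `p` is two-to-one: hence the factor `2`.
-/

open Real Set MeasureTheory Filter Topology

/-- The even extension of `arcosh` to `ℝ` that vanishes on `[-1, 1]`. By Jensen's formula
`arcoshPlus u` is the logarithmic Mahler measure of `y² + 2 u y + 1`. -/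
noncomputable def arcoshPlus (u : ℝ) : ℝ := arcosh (max 1 |u|)

@[simp] lemma arcoshPlus_neg (u : ℝ) : arcoshPlus (-u) = arcoshPlus u := by
  rw [arcoshPlus, abs_neg, arcoshPlus]

lemma arcoshPlus_of_abs_le_one {u : ℝ} (hu : |u| ≤ 1) : arcoshPlus u = 0 := by
  rw [arcoshPlus, max_eq_left hu, arcosh_zero]

lemma arcoshPlus_of_one_le {u : ℝ} (hu : 1 ≤ u) : arcoshPlus u = arcosh u := by
  rw [arcoshPlus, abs_of_nonneg (zero_le_one.trans hu), max_eq_right hu]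

@[fun_prop] lemma continuous_arcoshPlus : Continuous arcoshPlus :=
  continuousOn_arcosh.comp_continuous (by fun_prop) fun u ↦ mem_Ici.2 (le_max_left 1 |u|)

lemma monotoneOn_arcoshPlus : MonotoneOn arcoshPlus (Ici (-1)) := fun u hu v _ huv ↦ by
  refine (arcosh_le_arcosh (by positivity) (by positivity)).2 (max_le (le_max_left 1 |v|) ?_)
  rcases le_total u 1 with h | h
  · exact (abs_le.2 ⟨hu, h⟩).trans (le_max_left 1 |v|)
  · rw [abs_of_nonneg (by linarith)]
    exact (huv.trans (le_abs_self v)).trans (le_max_right 1 |v|)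

lemma log_max_one_abs_le_arcoshPlus (u : ℝ) : log (max 1 |u|) ≤ arcoshPlus u := by
  rw [log_le_iff_le_exp (by positivity), arcoshPlus, exp_arcosh (le_max_left 1 |u|)]
  linarith [sqrt_nonneg (max 1 |u| ^ 2 - 1)]

lemma arcoshPlus_le_log_two_mul (u : ℝ) : arcoshPlus u ≤ log (2 * max 1 |u|) := by
  have hsqrt : √(max 1 |u| ^ 2 - 1) ≤ max 1 |u| :=
    sqrt_le_iff.2 ⟨by positivity, by linarith⟩
  rw [le_log_iff_exp_le (by positivity), arcoshPlus, exp_arcosh (le_max_left 1 |u|)]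
  linarith

lemma tendsto_arcoshPlus_add_mul_sub_log {a : ℝ} (ha : 0 < a) (b : ℝ) :
    Tendsto (fun K ↦ arcoshPlus (b + a * K) - log K) atTop (𝓝 (log (2 * a))) := by
  have hlim : Tendsto (fun K : ℝ ↦ (b * K⁻¹ + a) + √((b * K⁻¹ + a) ^ 2 - K⁻¹ ^ 2)) atTop
      (𝓝 ((b * 0 + a) + √((b * 0 + a) ^ 2 - 0 ^ 2))) := by
    have hinv := tendsto_inv_atTop_zero (𝕜 := ℝ)
    have hlin := (hinv.const_mul b).add_const a
    exact hlin.add ((hlin.pow 2).sub (hinv.pow 2)).sqrt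
  rw [mul_zero, zero_add, zero_pow two_ne_zero, sub_zero, sqrt_sq ha.le, ← two_mul] at hlim
  refine (hlim.log (by positivity)).congr' ?_
  have hu : Tendsto (fun K ↦ b + a * K) atTop atTop :=
    tendsto_atTop_add_const_left _ b (tendsto_id.const_mul_atTop ha)
  filter_upwards [hu.eventually_ge_atTop 1, eventually_gt_atTop 0] with K hK hK0
  have hfactor : (b * K⁻¹ + a) + √((b * K⁻¹ + a) ^ 2 - K⁻¹ ^ 2)
      = exp (arcosh (b + a * K)) / K := by
    have hsq : (b * K⁻¹ + a) ^ 2 - K⁻¹ ^ 2 = ((b + a * K) ^ 2 - 1) / K ^ 2 := by field_simp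
    rw [hsq, sqrt_div' _ (sq_nonneg K), sqrt_sq hK0.le, exp_arcosh hK]
    field_simp
  rw [hfactor, log_div (exp_ne_zero _) hK0.ne', log_exp, arcoshPlus_of_one_le hK]

lemma hasDerivAt_arcoshPlus {u : ℝ} (hu : -1 < u) (hu1 : u ≠ 1) :
    HasDerivAt arcoshPlus (√(u ^ 2 - 1))⁻¹ u := by
  rcases hu1.lt_or_gt with h | h
  · rw [sqrt_eq_zero_of_nonpos (by nlinarith), inv_zero]
    refine (hasDerivAt_const u (0 : ℝ)).congr_of_eventuallyEq ?_
    filter_upwards [Ioo_mem_nhds hu h] with v hv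
    exact arcoshPlus_of_abs_le_one (abs_le.2 ⟨hv.1.le, hv.2.le⟩)
  · refine (hasDerivAt_arcosh h).congr_of_eventuallyEq ?_
    filter_upwards [Ioi_mem_nhds h] with v hv
    exact arcoshPlus_of_one_le (le_of_lt hv)

lemma lintegral_deriv_of_monotoneOn {f f' : ℝ → ℝ} {a b : ℝ} {s : Set ℝ} (hab : a ≤ b)
    (hf : MonotoneOn f (Icc a b)) (hcont : ContinuousOn f (Icc a b)) (hs : s.Countable)
    (hderiv : ∀ x ∈ Ioo a b \ s, HasDerivAt f (f' x) x) :
    ∫⁻ x in Ioc a b, ENNReal.ofReal (f' x) = ENNReal.ofReal (f b - f a) := by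
  have hmem : ∀ᵐ x ∂volume.restrict (Ioc a b), x ∈ Ioo a b \ s := by
    rw [← restrict_Ioo_eq_restrict_Ioc]
    filter_upwards [ae_restrict_mem measurableSet_Ioo,
      ae_restrict_of_ae (hs.ae_notMem volume)] with x hx hxs using ⟨hx, hxs⟩
  have hnonneg : 0 ≤ᵐ[volume.restrict (Ioc a b)] f' := by
    filter_upwards [hmem] with x hx
    have h := hf.derivWithin_nonneg (x := x)
    rwa [derivWithin_of_mem_nhds (Icc_mem_nhds hx.1.1 hx.1.2), (hderiv x hx).deriv] at h
  have hint : IntegrableOn f' (Ioc a b) := by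
    rw [← uIcc_of_le hab] at hf
    refine ((intervalIntegrable_iff_integrableOn_Ioc_of_le hab).1
      hf.intervalIntegrable_deriv).congr ?_
    filter_upwards [hmem] with x hx using (hderiv x hx).deriv
  rw [← ofReal_integral_eq_lintegral_ofReal hint hnonneg,
    ← intervalIntegral.integral_of_le hab,
    integral_eq_of_hasDerivAt_off_countable_of_le f f' hab hs hcont hderiv
      ((intervalIntegrable_iff_integrableOn_Ioc_of_le hab).2 hint)]

lemma lintegral_deriv_arcoshPlus_affine {α β K L : ℝ} (hβ : 0 ≤ β) (hK : -1 ≤ α + β * K)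
    (hKL : K ≤ L) :
    ∫⁻ κ in Ioc K L, ENNReal.ofReal (β * (√((α + β * κ) ^ 2 - 1))⁻¹)
      = ENNReal.ofReal (arcoshPlus (α + β * L) - arcoshPlus (α + β * K)) := by
  rcases hβ.eq_or_lt with rfl | hβ
  · simp
  refine lintegral_deriv_of_monotoneOn (f := fun κ ↦ arcoshPlus (α + β * κ))
    (s := {(1 - α) / β}) hKL ?_ (by fun_prop) (countable_singleton _) fun κ hκ ↦ ?_
  · have hmaps : ∀ κ ∈ Icc K L, -1 ≤ α + β * κ := fun κ hκ ↦ hK.trans (by gcongr; exact hκ.1)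
    exact fun κ hκ μ hμ h ↦ monotoneOn_arcoshPlus (hmaps κ hκ) (hmaps μ hμ) (by gcongr)
  · have hlt : -1 < α + β * κ := hK.trans_lt (by gcongr; exact hκ.1.1)
    have hne : α + β * κ ≠ 1 := fun h ↦ hκ.2 (by rw [mem_singleton_iff, ← h]; field_simp; ring)
    have hlin : HasDerivAt (fun κ ↦ α + β * κ) β κ := by
      simpa using ((hasDerivAt_id κ).const_mul β).const_add α
    exact ((hasDerivAt_arcoshPlus hlt hne).comp κ hlin).congr_deriv (mul_comm _ _)

lemma arcoshPlus_neg_add_mul (a b κ : ℝ) :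
    arcoshPlus (-a + b * κ) = arcoshPlus (a + b * -κ) := by
  rw [← arcoshPlus_neg, neg_add, neg_neg, mul_neg]

lemma abs_arcoshPlus_add_mul_sub_log_le {a b B K : ℝ} (ha : 0 < a) (hb : |b| ≤ B) (hK : 1 ≤ K) :
    |arcoshPlus (b + a * K) - log K| ≤ log (4 * (1 + B)) + |log a| := by
  have hB : 0 ≤ B := (abs_nonneg b).trans hb
  set M := max 1 |b + a * K|
  have hM1 : 1 ≤ M := le_max_left _ _
  have hlower : log a + log K ≤ log (4 * (1 + B)) + log M := by
    rw [← log_mul ha.ne' (by positivity), ← log_mul (by positivity) (by positivity)]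
    refine log_le_log (by positivity) ?_
    have : b + a * K ≤ M := (le_abs_self _).trans (le_max_right _ _)
    nlinarith [neg_le_of_abs_le hb, mul_nonneg hB (sub_nonneg.2 hM1)]
  have hupper : log (2 * M) ≤ log (4 * (1 + B)) + |log a| + log K := by
    set E := exp |log a|
    have hE1 : 1 ≤ E := one_le_exp (abs_nonneg _)
    have haE : a ≤ E := (exp_log ha).symm.le.trans (exp_le_exp.2 (le_abs_self _))
    rw [← log_exp |log a|, ← log_mul (by positivity) (by positivity),
      ← log_mul (by positivity) (by positivity)]
    refine log_le_log (by positivity) ?_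
    have hEK : 1 ≤ E * K := one_le_mul_of_one_le_of_one_le hE1 hK
    have hM : M ≤ (1 + B) + E * K := max_le (by nlinarith) <|
      (abs_add_le _ _).trans <| by
        rw [abs_of_nonneg (by positivity : 0 ≤ a * K)]
        nlinarith
    nlinarith
  rw [abs_le]
  constructor
  · linarith [log_max_one_abs_le_arcoshPlus (b + a * K), neg_abs_le (log a)]
  · linarith [arcoshPlus_le_log_two_mul (b + a * K)]

section AffinePencil

variable {Ω : Type*} [MeasurableSpace Ω] {μ : Measure Ω} {α β : Ω → ℝ} {K L : ℝ}

/-- The average of `arcoshPlus` over the members at parameter `κ` of the affine family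
`κ ↦ α ω + β ω * κ`. Both Mahler measures of the theorem have this shape. -/
noncomputable def pencilIntegral (μ : Measure Ω) (α β : Ω → ℝ) (κ : ℝ) : ℝ :=
  ∫ ω, arcoshPlus (α ω + β ω * κ) ∂μ

/-- The derivative in `κ` of `pencilIntegral μ α β` while its members stay above `-1`, valued in
`ℝ≥0∞` because it may be infinite. Members in `[-1, 1]` contribute `0`, through `√x = 0` for
`x ≤ 0` and `0⁻¹ = 0`. -/
noncomputable def pencilDensity (μ : Measure Ω) (α β : Ω → ℝ) (κ : ℝ) : ENNReal :=
  ∫⁻ ω, ENNReal.ofReal (β ω * (√((α ω + β ω * κ) ^ 2 - 1))⁻¹) ∂μ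

lemma pencilIntegral_neg_left (κ : ℝ) : pencilIntegral μ (-α) β κ = pencilIntegral μ α β (-κ) := by
  simp only [pencilIntegral, Pi.neg_apply, arcoshPlus_neg_add_mul]

lemma pencilDensity_neg_left (κ : ℝ) : pencilDensity μ (-α) β κ = pencilDensity μ α β (-κ) := by
  refine lintegral_congr fun ω ↦ ?_
  congr 5
  simp only [Pi.neg_apply]
  ring

lemma pencilIntegral_sub [SFinite μ] (hα : Measurable α) (hβ : Measurable β)
    (hβ0 : ∀ᵐ ω ∂μ, 0 ≤ β ω) (hK : ∀ᵐ ω ∂μ, -1 ≤ α ω + β ω * K) (hKL : K ≤ L)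
    (hintK : Integrable (fun ω ↦ arcoshPlus (α ω + β ω * K)) μ)
    (hintL : Integrable (fun ω ↦ arcoshPlus (α ω + β ω * L)) μ) :
    pencilIntegral μ α β L - pencilIntegral μ α β K
      = (∫⁻ κ in Ioc K L, pencilDensity μ α β κ).toReal := by
  have hmono : ∀ᵐ ω ∂μ, 0 ≤ arcoshPlus (α ω + β ω * L) - arcoshPlus (α ω + β ω * K) := by
    filter_upwards [hβ0, hK] with ω hω0 hωK
    have hle : α ω + β ω * K ≤ α ω + β ω * L := by gcongr
    exact sub_nonneg.2 (monotoneOn_arcoshPlus hωK (hωK.trans hle) hle)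
  unfold pencilIntegral pencilDensity
  rw [← integral_sub hintL hintK, integral_eq_lintegral_of_nonneg_ae hmono (by fun_prop),
    lintegral_lintegral_swap (by fun_prop)]
  congr 1
  refine lintegral_congr_ae ?_
  filter_upwards [hβ0, hK] with ω hω0 hωK
  exact (lintegral_deriv_arcoshPlus_affine hω0 hωK hKL).symm

lemma pencilIntegral_eq_lintegral_pencilDensity [SFinite μ] (hα : Measurable α)
    (hβ : Measurable β) (hβ0 : ∀ᵐ ω ∂μ, 0 ≤ β ω) (hα1 : ∀ᵐ ω ∂μ, |α ω| ≤ 1) (hL : 0 ≤ L)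
    (hintL : Integrable (fun ω ↦ arcoshPlus (α ω + β ω * L)) μ) :
    pencilIntegral μ α β L = (∫⁻ κ in Ioc 0 L, pencilDensity μ α β κ).toReal := by
  have hzero : (fun ω ↦ arcoshPlus (α ω + β ω * 0)) =ᵐ[μ] 0 := by
    filter_upwards [hα1] with ω hω
    rw [mul_zero, add_zero, arcoshPlus_of_abs_le_one hω, Pi.zero_apply]
  have hpencil : pencilIntegral μ α β 0 = 0 := integral_eq_zero_of_ae hzero
  rw [← pencilIntegral_sub hα hβ hβ0 _ hL ((integrable_zero ..).congr hzero.symm) hintL, hpencil,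
    sub_zero]
  filter_upwards [hα1] with ω hω
  rw [mul_zero, add_zero]
  exact neg_le_of_abs_le hω

lemma tendsto_pencilIntegral_sub_log [IsFiniteMeasure μ] (hα : Measurable α) (hβ : Measurable β)
    (hβ0 : ∀ᵐ ω ∂μ, 0 < β ω) (hlog : Integrable (fun ω ↦ log (2 * β ω)) μ) {B : ℝ}
    (hB : ∀ᵐ ω ∂μ, |α ω| ≤ B) :
    Tendsto (fun K ↦ pencilIntegral μ α β K - μ.real univ * log K) atTop
      (𝓝 (∫ ω, log (2 * β ω) ∂μ)) := by
  have hbound : ∀ K, 1 ≤ K → ∀ᵐ ω ∂μ,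
      ‖arcoshPlus (α ω + β ω * K) - log K‖ ≤ log (4 * (1 + B)) + |log (β ω)| := fun K hK ↦ by
    filter_upwards [hβ0, hB] with ω hω0 hωB
    exact abs_arcoshPlus_add_mul_sub_log_le hω0 hωB hK
  have hlogβ : Integrable (fun ω ↦ log (β ω)) μ := by
    refine (hlog.sub (integrable_const (log 2))).congr ?_
    filter_upwards [hβ0] with ω hω0
    rw [Pi.sub_apply, log_mul two_ne_zero hω0.ne', add_sub_cancel_left]
  have hdom : Integrable (fun ω ↦ log (4 * (1 + B)) + |log (β ω)|) μ :=
    (integrable_const _).add hlogβ.abs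
  have hmeas : ∀ K, AEStronglyMeasurable (fun ω ↦ arcoshPlus (α ω + β ω * K) - log K) μ :=
    fun K ↦ by fun_prop
  refine (tendsto_integral_filter_of_dominated_convergence _ (Eventually.of_forall hmeas)
    ((eventually_ge_atTop 1).mono hbound) hdom ?_).congr' ?_
  · filter_upwards [hβ0] with ω hω0 using tendsto_arcoshPlus_add_mul_sub_log hω0 (α ω)
  · filter_upwards [eventually_ge_atTop 1] with K hK
    have hint : Integrable (fun ω ↦ arcoshPlus (α ω + β ω * K)) μ :=
      ((hdom.mono' (hmeas K) (hbound K hK)).add (integrable_const (log K))).congr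
        (ae_of_all _ fun _ ↦ sub_add_cancel _ _)
    rw [integral_sub hint (integrable_const _), integral_const, smul_eq_mul, pencilIntegral]

end AffinePencil

lemma exists_add_eq_two_mul_and_mul_eq_one (u : ℝ) : ∃ z w : ℂ, z + w = 2 * u ∧ z * w = 1 ∧
    log⁺ ‖z‖ + log⁺ ‖w‖ = arcoshPlus u := by
  wlog hu0 : 0 ≤ u generalizing u
  · obtain ⟨z, w, hsum, hprod, hlog⟩ := this (-u) (by linarith)
    refine ⟨-z, -w, ?_, by rw [neg_mul_neg, hprod], by rw [norm_neg, norm_neg, hlog,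
      arcoshPlus_neg]⟩
    rw [← neg_add, hsum, Complex.ofReal_neg]
    ring
  rcases le_total u 1 with hu | hu
  · refine ⟨Complex.exp (arccos u * Complex.I), Complex.exp (-arccos u * Complex.I), ?_, ?_, ?_⟩
    · rw [← Complex.two_cos, ← Complex.ofReal_cos, cos_arccos (by linarith) hu]
    · rw [← Complex.exp_add, neg_mul, add_neg_cancel, Complex.exp_zero]
    · rw [← Complex.ofReal_neg, Complex.norm_exp_ofReal_mul_I, Complex.norm_exp_ofReal_mul_I,
        arcoshPlus_of_abs_le_one (abs_le.2 ⟨by linarith, hu⟩), posLog_one, add_zero]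
  · refine ⟨Complex.exp (arcosh u), Complex.exp (-arcosh u), ?_, ?_, ?_⟩
    · rw [← Complex.two_cosh, ← Complex.ofReal_cosh, cosh_arcosh hu]
    · rw [← Complex.exp_add, add_neg_cancel, Complex.exp_zero]
    · rw [← Complex.ofReal_neg, Complex.norm_exp_ofReal, Complex.norm_exp_ofReal, posLog_apply,
        posLog_apply, log_exp, log_exp, max_eq_right (arcosh_nonneg hu),
        max_eq_left (neg_nonpos.2 (arcosh_nonneg hu)), add_zero, arcoshPlus_of_one_le hu]

open Polynomial in
lemma logMahlerMeasure_quadratic {a ω : ℂ} (ha : a ≠ 0) (hω : ‖ω‖ = 1) (u : ℝ) :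
    (C a * (X ^ 2 + C (2 * u * ω) * X + C (ω ^ 2))).logMahlerMeasure
      = Real.log ‖a‖ + arcoshPlus u := by
  obtain ⟨z, w, hsum, hprod, hlog⟩ := exists_add_eq_two_mul_and_mul_eq_one u
  have hfactor : (X ^ 2 + C (2 * u * ω) * X + C (ω ^ 2) : ℂ[X])
      = (X + C (z * ω)) * (X + C (w * ω)) := by
    rw [← hsum, show ω ^ 2 = (z * w) * ω ^ 2 by rw [hprod, one_mul]]
    simp only [map_mul, map_add, map_pow]
    ring
  have hne : ((X + C (z * ω)) * (X + C (w * ω)) : ℂ[X]) ≠ 0 :=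
    mul_ne_zero (X_add_C_ne_zero _) (X_add_C_ne_zero _)
  rw [hfactor, logMahlerMeasure_C_mul ha hne, logMahlerMeasure_mul_eq_add_logMahlerMeasure hne,
    logMahlerMeasure_X_add_C, logMahlerMeasure_X_add_C, norm_mul, norm_mul, hω, mul_one, mul_one,
    hlog]

section Fubini

variable {X Y : Type*} [MeasurableSpace X] [MeasurableSpace Y] {μ : Measure X} {ν : Measure Y}

lemma integrable_prod_of_le_of_le_integral [SFinite μ] [SFinite ν] {f g : X × Y → ℝ} {l : X → ℝ}
    (hf : AEStronglyMeasurable f (μ.prod ν)) (hg : Integrable g (μ.prod ν))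
    (hfg : f ≤ᵐ[μ.prod ν] g) (hfiber : ∀ᵐ x ∂μ, Integrable (fun y ↦ f (x, y)) ν)
    (hl : Integrable l μ) (hlf : ∀ᵐ x ∂μ, l x ≤ ∫ y, f (x, y) ∂ν) :
    Integrable f (μ.prod ν) := by
  suffices hgap : Integrable (fun z ↦ g z - f z) (μ.prod ν) from
    (hg.sub hgap).congr (ae_of_all _ fun _ ↦ sub_sub_cancel _ _)
  have hmeas : AEStronglyMeasurable (fun z ↦ g z - f z) (μ.prod ν) := hg.1.sub hf
  refine (integrable_prod_iff hmeas).2 ⟨?_, ?_⟩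
  · filter_upwards [hg.prod_right_ae, hfiber] with x hgx hfx using hgx.sub hfx
  · refine (hg.integral_prod_left.sub hl).mono' hmeas.norm.integral_prod_right' ?_
    filter_upwards [hg.prod_right_ae, hfiber, Measure.ae_ae_of_ae_prod hfg, hlf]
      with x hgx hfx hle hlx
    have hnorm : ∀ᵐ y ∂ν, ‖g (x, y) - f (x, y)‖ = g (x, y) - f (x, y) := by
      filter_upwards [hle] with y hy using norm_of_nonneg (sub_nonneg.2 hy)
    rw [norm_of_nonneg (integral_nonneg fun _ ↦ norm_nonneg _), integral_congr_ae hnorm,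
      integral_sub hgx hfx]
    exact sub_le_sub_left hlx _

end Fubini

section UnitCircle

open Polynomial

lemma integrableOn_log_norm_eval_exp (p : ℂ[X]) :
    IntegrableOn (fun t : ℝ ↦ Real.log ‖p.eval (Complex.exp (t * Complex.I))‖) (Icc 0 (2 * π)) := by
  have h := p.intervalIntegrable_mahlerMeasure
  rw [intervalIntegrable_iff_integrableOn_Icc_of_le (by positivity)] at h
  simpa only [circleMap, zero_add, Complex.ofReal_one, one_mul] using h

lemma integral_log_norm_eval_exp (p : ℂ[X]) :
    ∫ t in Icc 0 (2 * π), Real.log ‖p.eval (Complex.exp (t * Complex.I))‖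
      = 2 * π * p.logMahlerMeasure := by
  rw [logMahlerMeasure_def, circleAverage_def, smul_eq_mul,
    intervalIntegral.integral_of_le (by positivity), ← integral_Icc_eq_integral_Ioc]
  simp only [circleMap, zero_add, Complex.ofReal_one, one_mul]
  rw [mul_inv_cancel_left₀ (by positivity)]

lemma ae_eval_exp_ne_zero {p : ℂ[X]} (hp : p ≠ 0) :
    ∀ᵐ t : ℝ, p.eval (Complex.exp (t * Complex.I)) ≠ 0 := by
  have hcount : (circleMap 0 1 ⁻¹' p.rootSet ℂ).Countable :=
    (p.rootSet_finite ℂ).countable.preimage_circleMap 0 one_ne_zero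
  filter_upwards [hcount.ae_notMem volume] with t ht h
  exact ht ((mem_rootSet_of_ne hp).2 (by simpa [circleMap] using h))

end UnitCircle

section Fiber

open Polynomial

variable {P : MvPolynomial (Fin 2) ℂ}

/-- The one-variable polynomial `P(x, ·)` obtained from `P` by fixing its first variable. -/
noncomputable def fiber (P : MvPolynomial (Fin 2) ℂ) (x : ℂ) : ℂ[X] :=
  MvPolynomial.aeval ![C x, X] P

lemma eval_fiber (P : MvPolynomial (Fin 2) ℂ) (x y : ℂ) :
    (fiber P x).eval y = MvPolynomial.eval ![x, y] P := by
  have h : ((Polynomial.aeval y).comp (MvPolynomial.aeval ![C x, X]) :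
      MvPolynomial (Fin 2) ℂ →ₐ[ℂ] ℂ) = MvPolynomial.aeval ![x, y] :=
    MvPolynomial.algHom_ext fun i ↦ by fin_cases i <;> simp
  simpa [fiber] using DFunLike.congr_fun h P

lemma fiber_eq_map (P : MvPolynomial (Fin 2) ℂ) (x : ℂ) :
    fiber P x = ((Bivariate.equivMvPolynomial ℂ).symm P).map (evalRingHom x) := by
  have h : (MvPolynomial.aeval ![C x, X] : MvPolynomial (Fin 2) ℂ →ₐ[ℂ] ℂ[X])
      = (mapAlgHom (Polynomial.aeval x)).comp (Bivariate.equivMvPolynomial ℂ).symm.toAlgHom :=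
    MvPolynomial.algHom_ext fun i ↦ by fin_cases i <;> simp
  simpa [fiber] using DFunLike.congr_fun h P

lemma exists_log_norm_eval_le_logMahlerMeasure_fiber (hP : P ≠ 0) :
    ∃ c : ℂ[X], c ≠ 0 ∧
      ∀ x, c.eval x ≠ 0 → Real.log ‖c.eval x‖ ≤ (fiber P x).logMahlerMeasure := by
  refine ⟨((Bivariate.equivMvPolynomial ℂ).symm P).leadingCoeff, by simpa using hP, fun x hx ↦ ?_⟩
  rw [logMahlerMeasure_eq_log_MahlerMeasure, fiber_eq_map]
  refine Real.log_le_log (norm_pos_iff.2 hx) ?_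
  rw [← coe_evalRingHom, ← leadingCoeff_map_of_leadingCoeff_ne_zero (evalRingHom x) hx]
  exact leadingCoeff_le_mahlerMeasure _

lemma logNormOnTorus_eq_log_norm_eval_fiber (P : MvPolynomial (Fin 2) ℂ) (s t : ℝ) :
    logNormOnTorus P (s, t)
      = Real.log ‖(fiber P (Complex.exp (s * Complex.I))).eval (Complex.exp (t * Complex.I))‖ := by
  rw [eval_fiber, logNormOnTorus]

lemma restrict_torusPeriod : (volume : Measure (ℝ × ℝ)).restrict torusPeriod
    = (volume.restrict (Icc 0 (2 * π))).prod (volume.restrict (Icc 0 (2 * π))) := by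
  rw [torusPeriod, Measure.volume_eq_prod, Measure.prod_restrict]

lemma continuous_eval_torus (P : MvPolynomial (Fin 2) ℂ) :
    Continuous fun θ : ℝ × ℝ ↦ MvPolynomial.eval
      ![Complex.exp (θ.1 * Complex.I), Complex.exp (θ.2 * Complex.I)] P := by
  refine (MvPolynomial.continuous_eval P).comp (continuous_pi fun i ↦ ?_)
  fin_cases i
  · simp only [Fin.zero_eta, Matrix.cons_val_zero]
    fun_prop
  · simp only [Fin.mk_one, Matrix.cons_val_one]
    fun_prop

lemma mahlerIntegrable_of_ne_zero (hP : P ≠ 0) : MahlerIntegrable P := by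
  obtain ⟨c, hc, hle⟩ := exists_log_norm_eval_le_logMahlerMeasure_fiber hP
  have hcont := (continuous_eval_torus P).norm
  have hmeas : Measurable (logNormOnTorus P) := measurable_log.comp hcont.measurable
  have hcompact : IsCompact torusPeriod := isCompact_Icc.prod isCompact_Icc
  have hbound := hcont.continuousOn.integrableOn_compact (μ := volume) hcompact
  rw [MahlerIntegrable]
  rw [IntegrableOn, restrict_torusPeriod] at hbound ⊢
  refine integrable_prod_of_le_of_le_integral hmeas.aestronglyMeasurable hbound
    (ae_of_all _ fun θ ↦ log_le_self (norm_nonneg _)) (ae_of_all _ fun s ↦ ?_)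
    ((integrableOn_log_norm_eval_exp c).const_mul (2 * π)) ?_
  · simp only [logNormOnTorus_eq_log_norm_eval_fiber]
    exact integrableOn_log_norm_eval_exp _
  · filter_upwards [ae_restrict_of_ae (ae_eval_exp_ne_zero hc)] with s hs
    simp only [logNormOnTorus_eq_log_norm_eval_fiber, integral_log_norm_eval_exp]
    gcongr
    exact hle _ hs

lemma integral_logNormOnTorus (P : MvPolynomial (Fin 2) ℂ) (s : ℝ) :
    ∫ t in Icc 0 (2 * π), logNormOnTorus P (s, t)
      = 2 * π * (fiber P (Complex.exp (s * Complex.I))).logMahlerMeasure := by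
  simp only [logNormOnTorus_eq_log_norm_eval_fiber, integral_log_norm_eval_exp]

lemma integrableOn_logMahlerMeasure_fiber (hP : P ≠ 0) :
    IntegrableOn (fun s : ℝ ↦ (fiber P (Complex.exp (s * Complex.I))).logMahlerMeasure)
      (Icc 0 (2 * π)) := by
  have h := mahlerIntegrable_of_ne_zero hP
  rw [MahlerIntegrable, IntegrableOn, restrict_torusPeriod] at h
  have h2 := h.integral_prod_left.const_mul (2 * π)⁻¹
  simp only [integral_logNormOnTorus] at h2
  exact h2.congr (ae_of_all _ fun s ↦ by simp only; field_simp)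

lemma logMahler_eq_integral_logMahlerMeasure_fiber (hP : P ≠ 0) :
    logMahler P = (2 * π)⁻¹ *
      ∫ s in Icc 0 (2 * π), (fiber P (Complex.exp (s * Complex.I))).logMahlerMeasure := by
  have h := mahlerIntegrable_of_ne_zero hP
  rw [MahlerIntegrable, IntegrableOn, restrict_torusPeriod] at h
  rw [logMahler, restrict_torusPeriod, integral_prod _ h]
  simp only [integral_logNormOnTorus, integral_const_mul]
  rw [sq, mul_inv, mul_assoc, inv_mul_cancel_left₀ (by positivity)]

end Fiber

section HalfAngle

lemma two_mul_cos_mul_exp (x : ℝ) :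
    2 * (cos x : ℂ) * Complex.exp (x * Complex.I) = Complex.exp (x * Complex.I) ^ 2 + 1 := by
  have h : Complex.exp (-x * Complex.I) * Complex.exp (x * Complex.I) = 1 := by
    rw [← Complex.exp_add, neg_mul, neg_add_cancel, Complex.exp_zero]
  rw [Complex.ofReal_cos, Complex.two_cos]
  linear_combination h

lemma norm_two_mul_cos_mul_exp (x : ℝ) :
    ‖2 * (cos x : ℂ) * Complex.exp (x * Complex.I)‖ = |2 * cos x| := by
  rw [norm_mul, Complex.norm_exp_ofReal_mul_I, mul_one, ← norm_eq_abs, ← Complex.norm_real,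
    Complex.ofReal_mul, Complex.ofReal_ofNat]

lemma exp_half_sq (s : ℝ) :
    Complex.exp ((s / 2 : ℝ) * Complex.I) ^ 2 = Complex.exp (s * Complex.I) := by
  rw [← Complex.exp_nat_mul]
  congr 1
  push_cast
  ring

lemma ae_cos_half_ne_zero : ∀ᵐ s : ℝ, cos (s / 2) ≠ 0 := by
  have hcount : {s : ℝ | cos (s / 2) = 0}.Countable := by
    refine (countable_range fun n : ℤ ↦ (2 * (n : ℝ) + 1) * π).mono fun s hs ↦ ?_
    obtain ⟨n, hn⟩ := cos_eq_zero_iff.1 hs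
    exact ⟨n, by linarith⟩
  exact hcount.ae_notMem volume

lemma cos_half_pos {s : ℝ} (hs : s ∈ Ioo 0 π) : 0 < cos (s / 2) :=
  cos_pos_of_mem_Ioo ⟨by linarith [hs.1, pi_pos], by linarith [hs.2]⟩

lemma cos_eq_two_mul_cos_half_sq_sub_one (s : ℝ) : cos s = 2 * cos (s / 2) ^ 2 - 1 := by
  rw [← cos_two_mul, mul_div_cancel₀ s two_ne_zero]

lemma log_two_mul_cos_half (s : ℝ) : log (2 * cos (s / 2)) = log
    ‖(Polynomial.X + Polynomial.C 1 : Polynomial ℂ).eval (Complex.exp (s * Complex.I))‖ := by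
  rw [Polynomial.eval_add, Polynomial.eval_X, Polynomial.eval_C, ← exp_half_sq,
    ← two_mul_cos_mul_exp, norm_two_mul_cos_mul_exp, log_abs]

lemma integrableOn_log_two_mul_cos_half :
    IntegrableOn (fun s ↦ log (2 * cos (s / 2))) (Icc 0 (2 * π)) := by
  simp only [log_two_mul_cos_half]
  exact integrableOn_log_norm_eval_exp _

lemma integral_log_two_mul_cos_half : ∫ s in Icc 0 (2 * π), log (2 * cos (s / 2)) = 0 := by
  simp only [log_two_mul_cos_half, integral_log_norm_eval_exp]
  rw [Polynomial.logMahlerMeasure_X_add_C, norm_one, posLog_one, mul_zero]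

lemma setIntegral_Icc_two_pi_of_symm {g : ℝ → ℝ} (hg : IntegrableOn g (Icc 0 (2 * π)))
    (hsymm : ∀ s, g (2 * π - s) = g s) :
    ∫ s in Icc 0 (2 * π), g s = 2 * ∫ s in Ioo 0 π, g s := by
  have hπ := pi_pos
  have hint : ∀ {a b : ℝ}, 0 ≤ a → a ≤ b → b ≤ 2 * π → IntervalIntegrable g volume a b :=
    fun ha hab hb ↦ (intervalIntegrable_iff_integrableOn_Icc_of_le hab).2
      (hg.mono_set (Icc_subset_Icc ha hb))
  have hreflect : ∫ s in π..(2 * π), g s = ∫ s in 0..π, g s := by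
    have h := intervalIntegral.integral_comp_sub_left g (a := 0) (b := π) (2 * π)
    rw [sub_zero, show 2 * π - π = π by ring] at h
    rw [← h]
    simp only [hsymm]
  rw [integral_Icc_eq_integral_Ioc, ← intervalIntegral.integral_of_le (by linarith),
    ← intervalIntegral.integral_add_adjacent_intervals
      (hint le_rfl hπ.le (by linarith)) (hint hπ.le (by linarith) le_rfl),
    hreflect, ← two_mul, intervalIntegral.integral_of_le hπ.le, integral_Ioc_eq_integral_Ioo]

lemma Ioo_zero_pi_subset : Ioo 0 π ⊆ Icc 0 (2 * π) := fun _ hs ↦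
  ⟨hs.1.le, by linarith [hs.2, pi_pos]⟩

lemma cos_half_two_pi_sub (s : ℝ) : cos ((2 * π - s) / 2) = -cos (s / 2) := by
  rw [sub_div, mul_div_cancel_left₀ π two_ne_zero, cos_pi_sub]

lemma setIntegral_Ioo_log_two_mul_cos_half : ∫ s in Ioo 0 π, log (2 * cos (s / 2)) = 0 := by
  have h := setIntegral_Icc_two_pi_of_symm integrableOn_log_two_mul_cos_half fun s ↦ by
    rw [cos_half_two_pi_sub, mul_neg, log_neg_eq_log]
  rw [integral_log_two_mul_cos_half] at h
  linarith

end HalfAngle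

section Families

/-- The range `(0, π)` of the angle of the first variable; the rest of the circle follows by
complex conjugation. -/
noncomputable abbrev halfCircle : Measure ℝ := volume.restrict (Ioo 0 π)

/-- Constant term of the affine pencil of `Q_k`: for `x = exp(iθ)`, the polynomial `Q_k(x, ·)` is
the rotation by `x²` of `y² + 2 u y + 1` with `u = bosmanBase θ + bosmanSlope θ * k`. -/
noncomputable def bosmanBase (θ : ℝ) : ℝ := cos (2 * θ)

/-- Slope of the affine pencil of `Q_k`; see `bosmanBase`. -/
noncomputable def bosmanSlope (θ : ℝ) : ℝ := 1 + cos θ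

/-- Constant term of the affine pencil of `P_{2 - k}`: for `x = exp(is)`, the polynomial
`P_{2 - k}(x, ·)` is a multiple of the rotation by `-exp(is/2)` of `y² + 2 u y + 1` with
`u = boydBase s + boydSlope s * k`. -/
noncomputable def boydBase (s : ℝ) : ℝ := -cos (s / 2)

/-- Slope of the affine pencil of `P_{2 - k}`; see `boydBase`. -/
noncomputable def boydSlope (s : ℝ) : ℝ := (4 * cos (s / 2))⁻¹

lemma bosmanQ_ne_zero (k : ℂ) : bosmanQ k ≠ 0 := fun h ↦ by
  simpa [bosmanQ] using congrArg (MvPolynomial.eval ![0, 1]) h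

lemma boydP_ne_zero (k : ℂ) : boydP k ≠ 0 := fun h ↦ by
  have h2 := congrArg (MvPolynomial.eval ![0, 1]) h
  norm_num [boydP] at h2

open Polynomial in
lemma fiber_bosmanQ (k θ : ℝ) : fiber (bosmanQ k) (Complex.exp (θ * Complex.I))
    = C 1 * (X ^ 2 + C (2 * (bosmanBase θ + bosmanSlope θ * k : ℝ)
        * Complex.exp (θ * Complex.I) ^ 2) * X
      + C ((Complex.exp (θ * Complex.I) ^ 2) ^ 2)) := by
  refine Polynomial.funext fun y ↦ ?_
  have hx := two_mul_cos_mul_exp θ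
  rw [eval_fiber, bosmanBase, bosmanSlope, Real.cos_two_mul]
  generalize Complex.exp (θ * Complex.I) = x at hx
  simp only [bosmanQ, map_add, map_mul, map_pow, MvPolynomial.eval_X, MvPolynomial.eval_C,
    map_one, Matrix.cons_val_zero, Matrix.cons_val_one, eval_add, eval_mul, eval_pow, eval_X,
    eval_C, one_mul]
  push_cast [-Complex.ofReal_cos]
  linear_combination (-(2 * (Real.cos θ : ℂ) * x + x ^ 2 + 1) * y - k * x * y) * hx

open Polynomial in
lemma fiber_boydP (k : ℝ) {s : ℝ} (hs : Real.cos (s / 2) ≠ 0) :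
    fiber (boydP (2 - k)) (Complex.exp (s * Complex.I))
      = C (2 * Real.cos (s / 2) * Complex.exp ((s / 2 : ℝ) * Complex.I))
        * (X ^ 2 + C (2 * (boydBase s + boydSlope s * k : ℝ)
          * -Complex.exp ((s / 2 : ℝ) * Complex.I)) * X
        + C ((-Complex.exp ((s / 2 : ℝ) * Complex.I)) ^ 2)) := by
  refine Polynomial.funext fun y ↦ ?_
  have hω := two_mul_cos_mul_exp (s / 2)
  have hc : (Real.cos (s / 2) : ℂ) ≠ 0 := Complex.ofReal_ne_zero.2 hs
  rw [eval_fiber, ← exp_half_sq, boydBase, boydSlope]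
  generalize Complex.exp ((s / 2 : ℝ) * Complex.I) = ω at hω
  simp only [boydP, map_add, map_mul, map_pow, MvPolynomial.eval_X, MvPolynomial.eval_C,
    map_one, Matrix.cons_val_zero, Matrix.cons_val_one, eval_add, eval_mul, eval_pow, eval_X,
    eval_C]
  push_cast [-Complex.ofReal_cos]
  generalize ((Real.cos (s / 2) : ℝ) : ℂ) = c at hc hω
  field_simp
  linear_combination 4 * (-(y ^ 2) - (2 * c * ω + ω ^ 2 + 1) * y - ω ^ 2) * hω

lemma logMahlerMeasure_fiber_bosmanQ (k θ : ℝ) :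
    (fiber (bosmanQ k) (Complex.exp (θ * Complex.I))).logMahlerMeasure
      = arcoshPlus (bosmanBase θ + bosmanSlope θ * k) := by
  rw [fiber_bosmanQ, logMahlerMeasure_quadratic one_ne_zero
    (by rw [norm_pow, Complex.norm_exp_ofReal_mul_I, one_pow]), norm_one, log_one, zero_add]

lemma logMahlerMeasure_fiber_boydP (k : ℝ) {s : ℝ} (hs : cos (s / 2) ≠ 0) :
    (fiber (boydP (2 - k)) (Complex.exp (s * Complex.I))).logMahlerMeasure
      = log (2 * cos (s / 2)) + arcoshPlus (boydBase s + boydSlope s * k) := by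
  have hne : 2 * (cos (s / 2) : ℂ) * Complex.exp ((s / 2 : ℝ) * Complex.I) ≠ 0 :=
    mul_ne_zero (mul_ne_zero two_ne_zero (Complex.ofReal_ne_zero.2 hs)) (Complex.exp_ne_zero _)
  rw [fiber_boydP k hs, logMahlerMeasure_quadratic hne
    (by rw [norm_neg, Complex.norm_exp_ofReal_mul_I]), norm_two_mul_cos_mul_exp, log_abs]

lemma integrableOn_arcoshPlus_boyd (k : ℝ) :
    IntegrableOn (fun s ↦ arcoshPlus (boydBase s + boydSlope s * k)) (Icc 0 (2 * π)) := by
  refine ((integrableOn_logMahlerMeasure_fiber (boydP_ne_zero (2 - k))).sub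
    integrableOn_log_two_mul_cos_half).congr ?_
  filter_upwards [ae_restrict_of_ae ae_cos_half_ne_zero] with s hs
  simp only [Pi.sub_apply]
  rw [logMahlerMeasure_fiber_boydP k hs, add_sub_cancel_left]

lemma integrableOn_arcoshPlus_bosman (k : ℝ) :
    IntegrableOn (fun θ ↦ arcoshPlus (bosmanBase θ + bosmanSlope θ * k)) (Icc 0 (2 * π)) := by
  simpa only [logMahlerMeasure_fiber_bosmanQ] using
    integrableOn_logMahlerMeasure_fiber (bosmanQ_ne_zero k)

lemma logMahler_bosmanQ (k : ℝ) :
    logMahler (bosmanQ k) = π⁻¹ * pencilIntegral halfCircle bosmanBase bosmanSlope k := by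
  have hsymm : ∀ θ, arcoshPlus (bosmanBase (2 * π - θ) + bosmanSlope (2 * π - θ) * k)
      = arcoshPlus (bosmanBase θ + bosmanSlope θ * k) := fun θ ↦ by
    simp only [bosmanBase, bosmanSlope, Real.cos_two_mul, cos_two_pi_sub]
  rw [logMahler_eq_integral_logMahlerMeasure_fiber (bosmanQ_ne_zero k)]
  simp only [logMahlerMeasure_fiber_bosmanQ]
  rw [setIntegral_Icc_two_pi_of_symm (integrableOn_arcoshPlus_bosman k) hsymm, pencilIntegral,
    mul_inv_rev, mul_assoc, inv_mul_cancel_left₀ two_ne_zero]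

lemma logMahler_boydP (k : ℝ) :
    logMahler (boydP (2 - k)) = π⁻¹ * pencilIntegral halfCircle boydBase boydSlope k := by
  have hsymm : ∀ s, arcoshPlus (boydBase (2 * π - s) + boydSlope (2 * π - s) * k)
      = arcoshPlus (boydBase s + boydSlope s * k) := fun s ↦ by
    rw [← arcoshPlus_neg (boydBase s + boydSlope s * k)]
    simp only [boydBase, boydSlope, cos_half_two_pi_sub, mul_neg, inv_neg]
    congr 1
    ring
  have hjensen : ∀ᵐ s : ℝ ∂volume.restrict (Icc 0 (2 * π)),
      (fiber (boydP (2 - k)) (Complex.exp (s * Complex.I))).logMahlerMeasure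
        = log (2 * cos (s / 2)) + arcoshPlus (boydBase s + boydSlope s * k) := by
    filter_upwards [ae_restrict_of_ae ae_cos_half_ne_zero] with s hs
      using logMahlerMeasure_fiber_boydP k hs
  rw [logMahler_eq_integral_logMahlerMeasure_fiber (boydP_ne_zero _), integral_congr_ae hjensen,
    integral_add integrableOn_log_two_mul_cos_half (integrableOn_arcoshPlus_boyd k),
    integral_log_two_mul_cos_half, zero_add,
    setIntegral_Icc_two_pi_of_symm (integrableOn_arcoshPlus_boyd k) hsymm, pencilIntegral,
    mul_inv_rev, mul_assoc, inv_mul_cancel_left₀ two_ne_zero]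

end Families

section Substitution

lemma setLIntegral_mul_comp_eq_image {f f' v w : ℝ → ℝ} {s : Set ℝ} (hs : MeasurableSet s)
    (hf' : ∀ x ∈ s, HasDerivWithinAt f (f' x) s x) (hf : InjOn f s)
    (hvw : ∀ x ∈ s, |f' x| * w (f x) = v x) (g : ℝ → ENNReal) :
    ∫⁻ x in s, ENNReal.ofReal (v x) * g (f x) = ∫⁻ y in f '' s, ENNReal.ofReal (w y) * g y := by
  rw [lintegral_image_eq_lintegral_abs_deriv_mul hs hf' hf]
  refine setLIntegral_congr_fun hs fun x hx ↦ ?_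
  rw [← hvw x hx, ENNReal.ofReal_mul (abs_nonneg _), mul_assoc]

lemma setLIntegral_congr_set_of_ne_zero {Ω : Type*} [MeasurableSpace Ω] {μ : Measure Ω}
    {g : Ω → ENNReal} {s t : Set Ω} (hs : MeasurableSet s) (ht : MeasurableSet t)
    (h : ∀ᵐ x ∂μ, g x ≠ 0 → (x ∈ s ↔ x ∈ t)) : ∫⁻ x in s, g x ∂μ = ∫⁻ x in t, g x ∂μ := by
  rw [← lintegral_indicator hs, ← lintegral_indicator ht]
  refine lintegral_congr_ae ?_
  filter_upwards [h] with x hx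
  by_cases hg : g x = 0
  · rw [indicator_apply_eq_zero.2 fun _ ↦ hg, indicator_apply_eq_zero.2 fun _ ↦ hg]
  · classical
    rw [indicator_apply, indicator_apply]
    exact if_congr (hx hg) rfl rfl

lemma image_add_mul_cos_Ioo {r : ℝ} (hr : r ≠ 0) (a : ℝ) :
    (fun θ ↦ a + r * cos θ) '' Ioo 0 π = {x | (x - a) ^ 2 < r ^ 2} := by
  have hcos : cos '' Ioo 0 π = Ioo (-1) 1 := cosPartialHomeomorph.image_source_eq_target
  rw [← image_image (fun c ↦ a + r * c) cos, hcos]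
  ext x
  have hx : (x - a) ^ 2 < r ^ 2 ↔ (x - a) / r ∈ Ioo (-1 : ℝ) 1 := by
    rw [sq_lt_sq, mem_Ioo, ← abs_lt, abs_div, div_lt_one (abs_pos.2 hr)]
  rw [mem_ofPred_eq, hx]
  refine ⟨?_, fun h ↦ ⟨_, h, by field_simp; ring⟩⟩
  rintro ⟨c, hc, rfl⟩
  rwa [add_sub_cancel_left, mul_div_cancel_left₀ _ hr]

lemma setLIntegral_abs_sin_mul_comp_cos {r : ℝ} (hr : r ≠ 0) (a : ℝ) (g : ℝ → ENNReal) :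
    ∫⁻ θ in Ioo 0 π, ENNReal.ofReal |r * sin θ| * g (a + r * cos θ)
      = ∫⁻ x in {x | (x - a) ^ 2 < r ^ 2}, g x := by
  have hderiv : ∀ θ ∈ Ioo 0 π,
      HasDerivWithinAt (fun θ ↦ a + r * cos θ) (r * -sin θ) (Ioo 0 π) θ := fun θ _ ↦
    (((hasDerivAt_cos θ).const_mul r).const_add a).hasDerivWithinAt
  have hinj : InjOn (fun θ ↦ a + r * cos θ) (Ioo 0 π) := fun θ hθ η hη h ↦
    injOn_cos (Ioo_subset_Icc_self hθ) (Ioo_subset_Icc_self hη)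
      (mul_left_cancel₀ hr (add_left_cancel h))
  rw [← image_add_mul_cos_Ioo hr, lintegral_image_eq_lintegral_abs_deriv_mul measurableSet_Ioo
    hderiv hinj]
  simp only [mul_neg, abs_neg]

lemma exists_le_add_eq_mul_eq {m p : ℝ} (h : 4 * m ≤ p ^ 2) :
    ∃ v w : ℝ, v ≤ w ∧ v + w = p ∧ v * w = m := by
  have hsq := sq_sqrt (sub_nonneg.2 h)
  refine ⟨(p - √(p ^ 2 - 4 * m)) / 2, (p + √(p ^ 2 - 4 * m)) / 2, ?_, by ring, ?_⟩
  · linarith [sqrt_nonneg (p ^ 2 - 4 * m)]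
  · linear_combination -hsq / 4

lemma setLIntegral_comp_add_div {m : ℝ} {s : Set ℝ} (hs : MeasurableSet s)
    (hs0 : ∀ w ∈ s, w ≠ 0) (hsm : ∀ v ∈ s, ∀ w ∈ s, v * w ≠ m) (g : ℝ → ENNReal) :
    ∫⁻ w in s, ENNReal.ofReal |w|⁻¹ * g (w + m / w)
      = ∫⁻ p in (fun w ↦ w + m / w) '' s, ENNReal.ofReal (√(p ^ 2 - 4 * m))⁻¹ * g p := by
  refine setLIntegral_mul_comp_eq_image (f' := fun w ↦ (w - m / w) / w) hs
    (fun w hw ↦ ?_) (fun v hv w hw h ↦ ?_) (fun w hw ↦ ?_) g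
  · have hw0 := hs0 w hw
    refine (((hasDerivAt_id w).add ((hasDerivAt_inv hw0).const_mul m)).congr_deriv
      ?_).hasDerivWithinAt
    field_simp
    ring
  · have hv0 := hs0 v hv
    have hw0 := hs0 w hw
    have hfactor : (v - w) * (v * w - m) = 0 := by
      field_simp at h
      linear_combination h
    exact sub_eq_zero.1 ((mul_eq_zero.1 hfactor).resolve_right (sub_ne_zero.2 (hsm v hv w hw)))
  · have hw0 := hs0 w hw
    have hne : w - m / w ≠ 0 := fun h ↦ hsm w hw w hw <| by
      field_simp at h
      linear_combination h
    have hsq : (w + m / w) ^ 2 - 4 * m = (w - m / w) ^ 2 := by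
      field_simp
      ring
    rw [hsq, sqrt_sq_eq_abs, abs_div, div_mul_eq_mul_div, mul_inv_cancel₀ (abs_ne_zero.2 hne),
      one_div]

lemma setLIntegral_Iio_comp_add_div {m : ℝ} (hm : m < 0) (g : ℝ → ENNReal) :
    ∫⁻ w in Iio 0, ENNReal.ofReal |w|⁻¹ * g (w + m / w)
      = ∫⁻ p, ENNReal.ofReal (√(p ^ 2 - 4 * m))⁻¹ * g p := by
  have himage : (fun w ↦ w + m / w) '' Iio 0 = univ := eq_univ_of_forall fun p ↦ by
    obtain ⟨v, w, hvw, rfl, rfl⟩ := exists_le_add_eq_mul_eq (m := m) (p := p) (by nlinarith)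
    have hv : v < 0 := by
      by_contra! hv
      exact hm.not_ge (mul_nonneg hv (hv.trans hvw))
    exact ⟨v, hv, by simp only [mul_div_cancel_left₀ w hv.ne]⟩
  rw [setLIntegral_comp_add_div measurableSet_Iio (fun w hw ↦ hw.ne)
    (fun v hv w hw ↦ (hm.trans (mul_pos_of_neg_of_neg hv hw)).ne'), himage, setLIntegral_univ]

lemma two_mul_lt_add_sq_div {c w : ℝ} (hw : 0 < w) (hwc : w ≠ c) : 2 * c < w + c ^ 2 / w := by
  have hsub : w + c ^ 2 / w - 2 * c = (w - c) ^ 2 / w := by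
    field_simp
    ring
  have := div_pos (sq_pos_of_ne_zero (sub_ne_zero.2 hwc)) hw
  linarith

lemma exists_add_sq_div_eq {c p : ℝ} (hc : 0 < c) (hp : 2 * c < p) :
    (∃ v ∈ Ioo 0 c, v + c ^ 2 / v = p) ∧ ∃ w ∈ Ioi c, w + c ^ 2 / w = p := by
  obtain ⟨v, w, hvw, hadd, hmul⟩ := exists_le_add_eq_mul_eq (m := c ^ 2) (p := p) (by nlinarith)
  have hprod : 0 < (c - v) * (w - c) := by nlinarith
  have hv : v < c := by nlinarith
  have hw : c < w := by nlinarith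
  have hv0 : 0 < v := by nlinarith
  rw [← hmul]
  refine ⟨⟨v, ⟨hv0, hv⟩, ?_⟩, w, hw, ?_⟩
  · rw [mul_div_cancel_left₀ w hv0.ne', hadd]
  · rw [mul_div_cancel_right₀ v (hc.trans hw).ne', add_comm, hadd]

lemma image_add_sq_div_Ioo {c : ℝ} (hc : 0 < c) :
    (fun w ↦ w + c ^ 2 / w) '' Ioo 0 c = Ioi (2 * c) := by
  refine Subset.antisymm ?_ fun p hp ↦ (exists_add_sq_div_eq hc hp).1
  rintro _ ⟨w, hw, rfl⟩
  exact two_mul_lt_add_sq_div hw.1 hw.2.ne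

lemma image_add_sq_div_Ioi {c : ℝ} (hc : 0 < c) :
    (fun w ↦ w + c ^ 2 / w) '' Ioi c = Ioi (2 * c) := by
  refine Subset.antisymm ?_ fun p hp ↦ (exists_add_sq_div_eq hc hp).2
  rintro _ ⟨w, hw, rfl⟩
  exact two_mul_lt_add_sq_div (hc.trans hw) (ne_of_gt hw)

lemma setLIntegral_Ioi_comp_add_sq_div {c : ℝ} (hc : 0 < c) (g : ℝ → ENNReal) :
    ∫⁻ w in Ioi 0, ENNReal.ofReal |w|⁻¹ * g (w + c ^ 2 / w)
      = 2 * ∫⁻ p in Ioi (2 * c), ENNReal.ofReal (√(p ^ 2 - 4 * c ^ 2))⁻¹ * g p := by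
  have hsmall := setLIntegral_comp_add_div (m := c ^ 2) measurableSet_Ioo (s := Ioo 0 c)
    (fun w hw ↦ hw.1.ne') (fun v hv w hw ↦ by nlinarith [hv.1, hv.2, hw.1, hw.2]) g
  have hlarge := setLIntegral_comp_add_div (m := c ^ 2) measurableSet_Ioi (s := Ioi c)
    (fun w hw ↦ (hc.trans hw).ne') (fun v hv w hw ↦ by
      have := mul_lt_mul'' hv.out hw.out hc.le hc.le
      nlinarith) g
  rw [← Ioc_union_Ioi_eq_Ioi hc.le, lintegral_union measurableSet_Ioi
    (Ioc_disjoint_Ioi_same), setLIntegral_congr Ioo_ae_eq_Ioc.symm, hsmall, hlarge,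
    image_add_sq_div_Ioo hc, image_add_sq_div_Ioi hc, ← two_mul]

end Substitution

section Densities

/-- The weight `(4 - (p - κ)²)^(-1/2)`, set to zero outside `(κ - 2, κ + 2)`: `√x = 0` for `x ≤ 0`
and `0⁻¹ = 0`. It is the factor common to the densities of both pencils. -/
noncomputable def arcsineWeight (κ p : ℝ) : ENNReal := ENNReal.ofReal (√(2 ^ 2 - (p - κ) ^ 2))⁻¹

lemma sq_lt_sq_of_arcsineWeight_ne_zero {κ p : ℝ} (h : arcsineWeight κ p ≠ 0) :
    (p - κ) ^ 2 < 2 ^ 2 := by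
  contrapose! h
  rw [arcsineWeight, sqrt_eq_zero_of_nonpos (by linarith), inv_zero, ENNReal.ofReal_zero]

lemma measurableSet_sub_sq_lt (a b : ℝ) : MeasurableSet {x : ℝ | (x - a) ^ 2 < b} :=
  measurableSet_lt (by fun_prop) measurable_const

lemma boydSlope_mul_inv_sqrt (κ : ℝ) {s : ℝ} (hs : s ∈ Ioo 0 π) :
    boydSlope s * (√((boydBase s + boydSlope s * κ) ^ 2 - 1))⁻¹
      = |-2 * sin s| * ((√((κ + -2 * cos s) ^ 2 - 4 * (1 + κ)))⁻¹
        * (√(2 ^ 2 - (κ + -2 * cos s - κ) ^ 2))⁻¹) := by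
  have hC := cos_half_pos hs
  have hscale : (κ + -2 * cos s) ^ 2 - 4 * (1 + κ)
      = (4 * cos (s / 2)) ^ 2 * ((boydBase s + boydSlope s * κ) ^ 2 - 1) := by
    rw [cos_eq_two_mul_cos_half_sq_sub_one s, boydBase, boydSlope]
    field_simp
    ring
  have hsin : 2 ^ 2 - (κ + -2 * cos s - κ) ^ 2 = (-2 * sin s) ^ 2 := by
    linear_combination -4 * sin_sq_add_cos_sq s
  have hne : |-2 * sin s| ≠ 0 := abs_ne_zero.2
    (mul_ne_zero (by norm_num) (sin_pos_of_mem_Ioo hs).ne')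
  rw [hscale, hsin, sqrt_mul (sq_nonneg _), sqrt_sq (by positivity), mul_inv, ← boydSlope,
    sqrt_sq_eq_abs, mul_comm |-2 * sin s|, inv_mul_cancel_right₀ hne]

lemma pencilDensity_boyd (κ : ℝ) : pencilDensity halfCircle boydBase boydSlope κ
    = ∫⁻ p, ENNReal.ofReal (√(p ^ 2 - 4 * (1 + κ)))⁻¹ * arcsineWeight κ p := by
  have hcos : pencilDensity halfCircle boydBase boydSlope κ
      = ∫⁻ s in Ioo 0 π, ENNReal.ofReal |-2 * sin s|
        * (ENNReal.ofReal (√((κ + -2 * cos s) ^ 2 - 4 * (1 + κ)))⁻¹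
          * arcsineWeight κ (κ + -2 * cos s)) :=
    setLIntegral_congr_fun measurableSet_Ioo fun s hs ↦ by
      rw [boydSlope_mul_inv_sqrt κ hs, arcsineWeight, ENNReal.ofReal_mul (abs_nonneg _),
        ENNReal.ofReal_mul (by positivity)]
  rw [hcos, setLIntegral_abs_sin_mul_comp_cos (by norm_num) κ
    fun p ↦ ENNReal.ofReal (√(p ^ 2 - 4 * (1 + κ)))⁻¹ * arcsineWeight κ p, neg_sq]
  refine (setLIntegral_congr_set_of_ne_zero (measurableSet_sub_sq_lt _ _) .univ
    (ae_of_all _ fun p hp ↦ ?_)).trans (setLIntegral_univ _)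
  exact iff_of_true (sq_lt_sq_of_arcsineWeight_ne_zero (right_ne_zero_of_mul hp)) (mem_univ p)

lemma sq_mul_four_sub_sq {w : ℝ} (hw : w ≠ 0) (κ : ℝ) :
    w ^ 2 * (2 ^ 2 - (w + (1 + κ) / w - κ) ^ 2)
      = (w - 1) * (κ + 1 - w) * (w ^ 2 + (2 - κ) * w + (1 + κ)) := by
  field_simp
  ring

lemma two_mul_sin_sq_mul_bosman {θ κ w : ℝ} (hθ : κ - 1 + 2 * cos θ = w) (hw : w ≠ 0) :
    (2 * sin θ) ^ 2 * ((bosmanBase θ + bosmanSlope θ * κ) ^ 2 - 1)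
      = (bosmanSlope θ * w) ^ 2 * (2 ^ 2 - (w + (1 + κ) / w - κ) ^ 2) := by
  rw [mul_pow, mul_pow, sin_sq, mul_assoc (bosmanSlope θ ^ 2), sq_mul_four_sub_sq hw, bosmanBase,
    bosmanSlope, Real.cos_two_mul]
  subst hθ
  ring

lemma bosmanSlope_mul_inv_sqrt {θ κ w : ℝ} (hs : θ ∈ Ioo 0 π) (hθ : κ - 1 + 2 * cos θ = w)
    (hw : w ≠ 0) : bosmanSlope θ * (√((bosmanBase θ + bosmanSlope θ * κ) ^ 2 - 1))⁻¹
      = |2 * sin θ| * (|w|⁻¹ * (√(2 ^ 2 - (w + (1 + κ) / w - κ) ^ 2))⁻¹) := by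
  have hslope : 0 < bosmanSlope θ := by
    unfold bosmanSlope
    linarith [(mapsTo_cos_Ioo hs).1]
  have hsin : |2 * sin θ| ≠ 0 := abs_ne_zero.2
    (mul_ne_zero two_ne_zero (sin_pos_of_mem_Ioo hs).ne')
  have hsqrt := congrArg sqrt (two_mul_sin_sq_mul_bosman hθ hw)
  rw [sqrt_mul (sq_nonneg _), sqrt_mul (sq_nonneg _), sqrt_sq_eq_abs, sqrt_sq_eq_abs, abs_mul _ w,
    abs_of_pos hslope] at hsqrt
  rw [← mul_inv, ← div_eq_mul_inv, ← div_eq_mul_inv, ← mul_div_mul_left (bosmanSlope θ) _ hsin,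
    hsqrt]
  field_simp

lemma pencilDensity_bosman (κ : ℝ) : pencilDensity halfCircle bosmanBase bosmanSlope κ
    = ∫⁻ w in {w | (w - (κ - 1)) ^ 2 < 2 ^ 2},
      ENNReal.ofReal |w|⁻¹ * arcsineWeight κ (w + (1 + κ) / w) := by
  have hne : ∀ᵐ θ, θ ∈ Ioo 0 π → κ - 1 + 2 * cos θ ≠ 0 := by
    have hsub : {θ | θ ∈ Ioo 0 π ∧ κ - 1 + 2 * cos θ = 0}.Subsingleton := fun θ hθ η hη ↦
      injOn_cos (Ioo_subset_Icc_self hθ.1) (Ioo_subset_Icc_self hη.1) (by linarith [hθ.2, hη.2])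
    filter_upwards [hsub.countable.ae_notMem volume] with θ hθ hmem h using hθ ⟨hmem, h⟩
  rw [← setLIntegral_abs_sin_mul_comp_cos two_ne_zero (κ - 1)
    fun w ↦ ENNReal.ofReal |w|⁻¹ * arcsineWeight κ (w + (1 + κ) / w)]
  refine setLIntegral_congr_fun_ae measurableSet_Ioo ?_
  filter_upwards [hne] with θ hθ hmem
  rw [bosmanSlope_mul_inv_sqrt hmem rfl (hθ hmem), arcsineWeight,
    ENNReal.ofReal_mul (abs_nonneg _), ENNReal.ofReal_mul (by positivity)]

lemma factors_pos_of_ne_zero {κ w : ℝ} (hw : w ≠ 0)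
    (h : ENNReal.ofReal |w|⁻¹ * arcsineWeight κ (w + (1 + κ) / w) ≠ 0) :
    0 < (w - 1) * (κ + 1 - w) * (w ^ 2 + (2 - κ) * w + (1 + κ)) := by
  rw [← sq_mul_four_sub_sq hw]
  have := sq_lt_sq_of_arcsineWeight_ne_zero (right_ne_zero_of_mul h)
  exact mul_pos (sq_pos_of_ne_zero hw) (sub_pos.2 this)

lemma sub_sq_lt_two_sq_iff {κ w : ℝ} :
    (w - (κ - 1)) ^ 2 < 2 ^ 2 ↔ κ - 3 < w ∧ w < κ + 1 := by
  rw [sq_lt_sq, abs_two, abs_lt]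
  constructor <;> rintro ⟨h₁, h₂⟩ <;> constructor <;> linarith

lemma pencilDensity_bosman_of_lt_neg_one {κ : ℝ} (hκ : κ < -1) :
    pencilDensity halfCircle bosmanBase bosmanSlope κ
      = pencilDensity halfCircle boydBase boydSlope κ := by
  rw [pencilDensity_boyd, ← setLIntegral_Iio_comp_add_div (by linarith), pencilDensity_bosman]
  refine setLIntegral_congr_set_of_ne_zero (measurableSet_sub_sq_lt _ _) measurableSet_Iio ?_
  filter_upwards [Measure.ae_ne volume 0] with w hw hsupp
  have hpos := factors_pos_of_ne_zero hw hsupp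
  rw [sub_sq_lt_two_sq_iff, mem_Iio]
  refine ⟨fun h ↦ by linarith, fun hw0 ↦ ⟨?_, ?_⟩⟩
  · by_contra! hle
    have hquad : 0 < w ^ 2 + (2 - κ) * w + (1 + κ) := by
      have := mul_nonneg_of_nonpos_of_nonpos (by linarith : w + 3 - κ ≤ 0)
        (by linarith : w - 1 ≤ 0)
      linear_combination this + 4 * one_pos (α := ℝ)
    have hlin : (w - 1) * (κ + 1 - w) ≤ 0 :=
      mul_nonpos_of_nonpos_of_nonneg (by linarith) (by linarith)
    exact hpos.not_ge (mul_nonpos_of_nonpos_of_nonneg hlin hquad.le)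
  · by_contra! hle
    have hquad : w ^ 2 + (2 - κ) * w + (1 + κ) < 0 := by
      have := mul_nonpos_of_nonneg_of_nonpos (sub_nonneg.2 hle) hw0.le
      linear_combination this + 3 * hw0 + hκ
    have hlin : 0 ≤ (w - 1) * (κ + 1 - w) :=
      mul_nonneg_of_nonpos_of_nonpos (by linarith) (by linarith)
    exact hpos.not_ge (mul_nonpos_of_nonneg_of_nonpos hlin hquad.le)

lemma pencilDensity_boyd_of_pos {κ : ℝ} (hκ : 0 < κ) :
    pencilDensity halfCircle boydBase boydSlope κ = ∫⁻ p in Ioi (2 * √(1 + κ)),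
      ENNReal.ofReal (√(p ^ 2 - 4 * (1 + κ)))⁻¹ * arcsineWeight κ p := by
  rw [pencilDensity_boyd, ← setLIntegral_univ]
  refine setLIntegral_congr_set_of_ne_zero .univ measurableSet_Ioi (ae_of_all _ fun p hp ↦ ?_)
  have hnear := sq_lt_sq_of_arcsineWeight_ne_zero (right_ne_zero_of_mul hp)
  have hlarge : 4 * (1 + κ) < p ^ 2 := by
    by_contra! h
    exact left_ne_zero_of_mul hp (by
      rw [sqrt_eq_zero_of_nonpos (by linarith), inv_zero, ENNReal.ofReal_zero])
  have hp0 : 0 < p := by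
    by_contra! h
    have := mul_nonneg hκ.le (neg_nonneg.2 h)
    nlinarith [sq_nonneg κ]
  have hsqrt : √(4 * (1 + κ)) = 2 * √(1 + κ) := by
    rw [show (4 : ℝ) = 2 ^ 2 by norm_num, sqrt_mul (sq_nonneg _), sqrt_sq two_pos.le]
  rw [mem_Ioi, ← hsqrt]
  exact iff_of_true (mem_univ p) ((sqrt_lt' hp0).2 hlarge)

lemma pencilDensity_bosman_of_mem_Ioo {κ : ℝ} (hκ : κ ∈ Ioo 0 4) :
    pencilDensity halfCircle bosmanBase bosmanSlope κ
      = 2 * pencilDensity halfCircle boydBase boydSlope κ := by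
  have hc : 0 < 1 + κ := by linarith [hκ.1]
  have hfold := setLIntegral_Ioi_comp_add_sq_div (sqrt_pos.2 hc) (arcsineWeight κ)
  rw [sq_sqrt hc.le] at hfold
  rw [pencilDensity_boyd_of_pos hκ.1, ← hfold, pencilDensity_bosman]
  refine setLIntegral_congr_set_of_ne_zero (measurableSet_sub_sq_lt _ _) measurableSet_Ioi ?_
  filter_upwards [Measure.ae_ne volume 0] with w hw hsupp
  have hpos := factors_pos_of_ne_zero hw hsupp
  have hquad : 0 < w ^ 2 + (2 - κ) * w + (1 + κ) := by
    have hdisc : 0 < κ * (8 - κ) := mul_pos hκ.1 (by linarith [hκ.2])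
    linear_combination sq_nonneg (w + (2 - κ) / 2) + hdisc / 4
  have hprod : 0 < (w - 1) * (κ + 1 - w) := pos_of_mul_pos_left hpos hquad.le
  obtain ⟨hw1, hwκ⟩ : 1 < w ∧ w < κ + 1 := by
    rcases pos_and_pos_or_neg_and_neg_of_mul_pos hprod with h | h
    · exact ⟨by linarith [h.1], by linarith [h.2]⟩
    · linarith [h.1, h.2, hκ.1]
  rw [sub_sq_lt_two_sq_iff, mem_Ioi]
  exact iff_of_true ⟨by linarith [hκ.2], hwκ⟩ (by linarith)

end Densities

section Comparison

lemma measurable_bosmanBase : Measurable bosmanBase := by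
  unfold bosmanBase
  fun_prop

lemma measurable_bosmanSlope : Measurable bosmanSlope := by
  unfold bosmanSlope
  fun_prop

lemma measurable_boydBase : Measurable boydBase := by
  unfold boydBase
  fun_prop

lemma measurable_boydSlope : Measurable boydSlope := by
  unfold boydSlope
  fun_prop

lemma abs_bosmanBase_le_one (θ : ℝ) : |bosmanBase θ| ≤ 1 := abs_cos_le_one _

lemma abs_boydBase_le_one (s : ℝ) : |boydBase s| ≤ 1 := (abs_neg _).trans_le (abs_cos_le_one _)

lemma ae_bosmanSlope_pos : ∀ᵐ θ ∂halfCircle, 0 < bosmanSlope θ :=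
  ae_restrict_of_forall_mem measurableSet_Ioo fun θ hθ ↦ by
    unfold bosmanSlope
    linarith [(mapsTo_cos_Ioo hθ).1]

lemma ae_boydSlope_pos : ∀ᵐ s ∂halfCircle, 0 < boydSlope s :=
  ae_restrict_of_forall_mem measurableSet_Ioo fun _ hs ↦
    inv_pos.2 (mul_pos four_pos (cos_half_pos hs))

lemma log_two_mul_bosmanSlope (θ : ℝ) : log (2 * bosmanSlope θ) = 2 * log (2 * cos (θ / 2)) := by
  have hsq : 2 * bosmanSlope θ = (2 * cos (θ / 2)) ^ 2 := by
    rw [bosmanSlope, cos_eq_two_mul_cos_half_sq_sub_one]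
    ring
  rw [hsq, log_pow, Nat.cast_ofNat]

lemma log_two_mul_boydSlope (s : ℝ) : log (2 * boydSlope s) = -log (2 * cos (s / 2)) := by
  have hinv : 2 * boydSlope s = (2 * cos (s / 2))⁻¹ := by
    rw [boydSlope, mul_inv, mul_inv, ← mul_assoc]
    norm_num
  rw [hinv, log_inv]

lemma tendsto_bosman_pencilIntegral_sub_log :
    Tendsto (fun K ↦ pencilIntegral halfCircle (-bosmanBase) bosmanSlope K
      - halfCircle.real univ * log K) atTop (𝓝 0) := by
  have hlog : Integrable (fun θ ↦ log (2 * bosmanSlope θ)) halfCircle := by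
    simp only [log_two_mul_bosmanSlope]
    exact (integrableOn_log_two_mul_cos_half.mono_set Ioo_zero_pi_subset).const_mul 2
  have hmean : ∫ θ, log (2 * bosmanSlope θ) ∂halfCircle = 0 := by
    simp only [log_two_mul_bosmanSlope]
    rw [integral_const_mul, setIntegral_Ioo_log_two_mul_cos_half, mul_zero]
  rw [← hmean]
  exact tendsto_pencilIntegral_sub_log measurable_bosmanBase.neg measurable_bosmanSlope
    ae_bosmanSlope_pos hlog (ae_of_all _ fun θ ↦ (abs_neg _).trans_le (abs_bosmanBase_le_one θ))

lemma tendsto_boyd_pencilIntegral_sub_log :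
    Tendsto (fun K ↦ pencilIntegral halfCircle (-boydBase) boydSlope K
      - halfCircle.real univ * log K) atTop (𝓝 0) := by
  have hlog : Integrable (fun s ↦ log (2 * boydSlope s)) halfCircle := by
    simp only [log_two_mul_boydSlope]
    exact (integrableOn_log_two_mul_cos_half.mono_set Ioo_zero_pi_subset).neg
  have hmean : ∫ s, log (2 * boydSlope s) ∂halfCircle = 0 := by
    simp only [log_two_mul_boydSlope]
    rw [integral_neg, setIntegral_Ioo_log_two_mul_cos_half, neg_zero]
  rw [← hmean]
  exact tendsto_pencilIntegral_sub_log measurable_boydBase.neg measurable_boydSlope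
    ae_boydSlope_pos hlog (ae_of_all _ fun s ↦ (abs_neg _).trans_le (abs_boydBase_le_one s))

lemma pencilIntegral_bosman_of_mem_Icc {k : ℝ} (hk : k ∈ Icc 0 4) :
    pencilIntegral halfCircle bosmanBase bosmanSlope k
      = 2 * pencilIntegral halfCircle boydBase boydSlope k := by
  have hdensity : ∫⁻ κ in Ioc 0 k, pencilDensity halfCircle bosmanBase bosmanSlope κ
      = 2 * ∫⁻ κ in Ioc 0 k, pencilDensity halfCircle boydBase boydSlope κ := by
    rw [← lintegral_const_mul' _ _ ENNReal.ofNat_ne_top]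
    refine setLIntegral_congr_fun_ae measurableSet_Ioc ?_
    filter_upwards [Measure.ae_ne volume 4] with κ hκ4 hκ
    exact pencilDensity_bosman_of_mem_Ioo ⟨hκ.1, (hκ.2.trans hk.2).lt_of_ne hκ4⟩
  rw [pencilIntegral_eq_lintegral_pencilDensity measurable_bosmanBase measurable_bosmanSlope
      (ae_bosmanSlope_pos.mono fun _ ↦ le_of_lt) (ae_of_all _ abs_bosmanBase_le_one) hk.1
      ((integrableOn_arcoshPlus_bosman k).mono_set Ioo_zero_pi_subset),
    pencilIntegral_eq_lintegral_pencilDensity measurable_boydBase measurable_boydSlope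
      (ae_boydSlope_pos.mono fun _ ↦ le_of_lt) (ae_of_all _ abs_boydBase_le_one) hk.1
      ((integrableOn_arcoshPlus_boyd k).mono_set Ioo_zero_pi_subset),
    hdensity, ENNReal.toReal_mul, ENNReal.toReal_ofNat]

lemma pencilIntegral_neg_sub {α β : ℝ → ℝ} (hα : Measurable α) (hβ : Measurable β)
    (hα1 : ∀ s, |α s| ≤ 1) (hβ0 : ∀ᵐ s ∂halfCircle, 0 < β s)
    (hint : ∀ κ, IntegrableOn (fun s ↦ arcoshPlus (α s + β s * κ)) (Icc 0 (2 * π)))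
    {K L : ℝ} (hK : 0 ≤ K) (hKL : K ≤ L) :
    pencilIntegral halfCircle (-α) β L - pencilIntegral halfCircle (-α) β K
      = (∫⁻ κ in Ioc K L, pencilDensity halfCircle α β (-κ)).toReal := by
  have hint' : ∀ κ, Integrable (fun s ↦ arcoshPlus ((-α) s + β s * κ)) halfCircle := fun κ ↦ by
    simp only [Pi.neg_apply, arcoshPlus_neg_add_mul]
    exact (hint (-κ)).mono_set Ioo_zero_pi_subset
  simp only [← pencilDensity_neg_left]
  refine pencilIntegral_sub hα.neg hβ (hβ0.mono fun _ ↦ le_of_lt) ?_ hKL (hint' K) (hint' L)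
  filter_upwards [hβ0] with s hs
  have hbase : -1 ≤ (-α) s := neg_le_neg (le_of_abs_le (hα1 s))
  linarith [mul_nonneg hs.le hK]

lemma pencilIntegral_bosman_of_le_neg_one {k : ℝ} (hk : k ≤ -1) :
    pencilIntegral halfCircle bosmanBase bosmanSlope k
      = pencilIntegral halfCircle boydBase boydSlope k := by
  set bosman := pencilIntegral halfCircle (-bosmanBase) bosmanSlope with hbosman
  set boyd := pencilIntegral halfCircle (-boydBase) boydSlope with hboyd
  have hincrement : ∀ L, -k ≤ L → bosman L - bosman (-k) = boyd L - boyd (-k) := fun L hL ↦ by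
    have hk0 : 0 ≤ -k := by linarith
    rw [hbosman, hboyd,
      pencilIntegral_neg_sub measurable_bosmanBase measurable_bosmanSlope abs_bosmanBase_le_one
        ae_bosmanSlope_pos integrableOn_arcoshPlus_bosman hk0 hL,
      pencilIntegral_neg_sub measurable_boydBase measurable_boydSlope abs_boydBase_le_one
        ae_boydSlope_pos integrableOn_arcoshPlus_boyd hk0 hL]
    congr 1
    exact setLIntegral_congr_fun measurableSet_Ioc fun κ hκ ↦
      pencilDensity_bosman_of_lt_neg_one (by linarith [hκ.1])
  have hconst : (fun L ↦ bosman L - boyd L) =ᶠ[atTop] fun _ ↦ bosman (-k) - boyd (-k) := by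
    filter_upwards [eventually_ge_atTop (-k)] with L hL
    linarith [hincrement L hL]
  have hlim : Tendsto (fun L ↦ bosman L - boyd L) atTop (𝓝 0) := by
    simpa using tendsto_bosman_pencilIntegral_sub_log.sub tendsto_boyd_pencilIntegral_sub_log
  have heq := tendsto_nhds_unique (tendsto_const_nhds.congr' hconst.symm) hlim
  rw [hbosman, hboyd, pencilIntegral_neg_left, pencilIntegral_neg_left, neg_neg] at heq
  exact sub_eq_zero.1 heq

end Comparison

theorem theorem1 (k : ℝ) :
    (MahlerIntegrable (bosmanQ (k : ℂ)) ∧ MahlerIntegrable (boydP (2 - (k : ℂ)))) ∧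
    (0 ≤ k ∧ k ≤ 4 → logMahler (bosmanQ (k : ℂ)) = 2 * logMahler (boydP (2 - (k : ℂ)))) ∧
    (k ≤ -1 → logMahler (bosmanQ (k : ℂ)) = logMahler (boydP (2 - (k : ℂ)))) := by
  refine ⟨⟨mahlerIntegrable_of_ne_zero (bosmanQ_ne_zero k),
    mahlerIntegrable_of_ne_zero (boydP_ne_zero (2 - k))⟩, fun hk ↦ ?_, fun hk ↦ ?_⟩
  · rw [logMahler_bosmanQ, logMahler_boydP, pencilIntegral_bosman_of_mem_Icc hk, mul_left_comm]
  · rw [logMahler_bosmanQ, logMahler_boydP, pencilIntegral_bosman_of_le_neg_one hk]
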